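/- For $N\ge 1$ let $d=2^N$, let $\bar X=\prod_{i=1}^N X_i$ be the product of the Pauli $X$ operators on $N$ qubits, let $\mathcal H_+$ be the $+1$ eigenspace of $\bar X$ (of dimension $d/2$), and let $\rho_0=(\mathbb I+\bar X)/d$. There is an absolute constant $C>0$ such that the following holds. Let $(r_N)$ and $(k_N)$ be sequences of natural numbers with $\log N=o(\log r_N)$ and $\log r_N=o(N)$ (that is, $e^{\omega(\log N)}<r_N<e^{o(N)}$) and $k_N\le \mathrm{poly}(N)$. Then for all sufficiently large $N$ and every orthogonal projector $\Pi$ of rank $r=r_N$ whose range lies in $\mathcal H_+$, with $k=k_N$, $$\left\Vert\, \mathbb E_{U\sim \mathrm{Haar}(\mathcal H_+)}\left[\left(\frac{U\Pi U^\dagger}{r}\right)^{\otimes k}\right]-\rho_0^{\otimes k}\right\Vert_{\mathrm{tr}}\le C\,\frac{k^2}{r},$$ where $U$ is drawn from the Haar probability measure on the unitary group of $\mathcal H_+$ and is extended by zero to the orthogonal complement of $\mathcal H_+$, and $\Vert A\Vert_{\mathrm{tr}}=\mathrm{Tr}\sqrt{A^\dagger A}$. -/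

import Mathlib

open Filter Asymptotics MeasureTheory

namespace SWSSB

section Unitary

variable (F : Type*) [NormedAddCommGroup F] [InnerProductSpace ℂ F] [FiniteDimensional ℂ F]

/-- A finite-dimensional inner product space is complete (so that its operators have adjoints). -/
theorem completeSpace_of_finiteDimensional : CompleteSpace F :=
  FiniteDimensional.complete ℂ F

attribute [local instance] completeSpace_of_finiteDimensional

/-- The unitary group `U(F)`, with its norm topology and Borel sets. -/
abbrev UnitaryOn : Type _ :=
  unitary (F →L[ℂ] F)

instance instCompactSpaceUnitaryOn : CompactSpace (UnitaryOn F) := by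
  have : ProperSpace (F →L[ℂ] F) := FiniteDimensional.proper ℂ (F →L[ℂ] F)
  have hc : IsClosed (unitary (F →L[ℂ] F) : Set (F →L[ℂ] F)) := isClosed_unitary
  refine isCompact_iff_compactSpace.mp (Metric.isCompact_of_isClosed_isBounded hc
    ((Metric.isBounded_closedBall (x := 0) (r := 1)).subset fun U hU => ?_))
  rw [mem_closedBall_zero_iff]
  rcases subsingleton_or_nontrivial (F →L[ℂ] F) with h | h
  · simp [Subsingleton.elim U 0]
  · exact (CStarRing.norm_of_mem_unitary hU).le

/-- The Haar probability measure on `U(F)`. -/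
noncomputable def haarUnitary : Measure (UnitaryOn F) :=
  Measure.haarMeasure ⊤

variable {E : Type*} [NormedAddCommGroup E] [InnerProductSpace ℂ E] [FiniteDimensional ℂ E]

/-- A unitary `U` on a subspace `K` as an operator on the whole space: it is `U` on `K` and zero on
the orthogonal complement of `K`. -/
noncomputable def extendUnitary (K : Submodule ℂ E) (U : UnitaryOn K) : E →L[ℂ] E :=
  K.subtypeL ∘L (U : K →L[ℂ] K) ∘L K.orthogonalProjectionOnto

end Unitary

/-- The `k`-fold tensor power `A ^ ⊗ k` of a matrix, in the product basis of `k` copies. -/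
def tensorPower {ι : Type*} (k : ℕ) (A : Matrix ι ι ℂ) :
    Matrix (Fin k → ι) (Fin k → ι) ℂ :=
  Matrix.of fun x y => ∏ i, A (x i) (y i)

/-- The trace norm `Tr √(A† A)`, that is, the sum of the singular values of `A`. -/
noncomputable def traceNorm {ι : Type*} [Fintype ι] [DecidableEq ι] (A : Matrix ι ι ℂ) : ℝ :=
  ∑ i, Real.sqrt ((Matrix.isHermitian_conjTranspose_mul_self A).eigenvalues i)

/-- Labels of the computational basis of `N` qubits. -/
abbrev Bits (N : ℕ) : Type := Fin N → Fin 2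

/-- The `N`-qubit Hilbert space, of dimension `2 ^ N`. -/
abbrev Qubits (N : ℕ) : Type := EuclideanSpace ℂ (Bits N)

/-- The symmetry generator, the product of the Pauli `X` operators on all `N` qubits. -/
def xBar (N : ℕ) : Matrix (Bits N) (Bits N) ℂ :=
  tensorPower N !![0, 1; 1, 0]

/-- The symmetry sector `H₊`: the eigenspace of `xBar N` for the eigenvalue `+1`. -/
noncomputable def plusSector (N : ℕ) : Submodule ℂ (Qubits N) :=
  Module.End.eigenspace (Matrix.toEuclideanLin (xBar N)) 1

/-- The state `ρ₀ = (I + xBar) / 2 ^ N`. -/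
noncomputable def rhoZero (N : ℕ) : Matrix (Bits N) (Bits N) ℂ :=
  ((2 : ℂ) ^ N)⁻¹ • (1 + xBar N)

/-- `P` is an orthogonal projector of rank `r` on the `N`-qubit space whose range lies in `H₊`. -/
structure IsSectorProjector (N r : ℕ) (P : Matrix (Bits N) (Bits N) ℂ) : Prop where
  isStarProjection : IsStarProjection P
  rank_eq : P.rank = r
  range_le : LinearMap.range (Matrix.toEuclideanLin P) ≤ plusSector N

/-- The state `U P U† / r`, for `U` in `U(H₊)` extended by zero to the whole space. -/
noncomputable def sectorState {N : ℕ} (r : ℕ) (P : Matrix (Bits N) (Bits N) ℂ)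
    (U : UnitaryOn (plusSector N)) : Matrix (Bits N) (Bits N) ℂ :=
  let V : Matrix (Bits N) (Bits N) ℂ :=
    (Matrix.toEuclideanCLM (n := Bits N) (𝕜 := ℂ)).symm 
      (extendUnitary (plusSector N) U)
  (r : ℂ)⁻¹ • (V * P * V.conjTranspose)

/-- The average of `(U P U† / r) ^ ⊗ k` over Haar-random `U` in `U(H₊)`, taken entrywise. -/
noncomputable def haarMoment {N : ℕ} (r k : ℕ) (P : Matrix (Bits N) (Bits N) ℂ) :
    Matrix (Fin k → Bits N) (Fin k → Bits N) ℂ :=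
  Matrix.of fun x y =>
    ∫ U, tensorPower k (sectorState r P U) x y ∂(haarUnitary (plusSector N))

end SWSSB

/-!
The bound holds with the constant `4` for every `N ≠ 0` and `r ≠ 0`, and `log N = o(log r_N)` makes
`r_N` nonzero for large `N`.

Choose an orthonormal basis `b` of `H₊`, of size `D`, such that the projector is the sum of the
projectors onto `r` of its vectors, say those indexed by `S`. For a tuple `f` of `k` indices let
`M f` be the Haar average of the pure state of `U (b (f 0)) ⊗ ⋯ ⊗ U (b (f (k - 1)))`
(`productTwirl`). Expanding the tensor power, the Haar moment is the uniform mixture of the `M f`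
over the tuples `f` with entries in `S`. For every `U`, the projectors onto the vectors `U (b i)`
add up to the projector onto `H₊`, so `ρ₀ ^ ⊗ k` is the uniform mixture of the `M f` over all
tuples (`integral_tensorPower_eq_sum_productTwirl`).

Any two tuples without repetition are related by a permutation of the basis, which extends to a
unitary of `H₊`; since Haar measure on a compact group is right invariant, `M f` is the same state
for all of them (`productTwirl_eq_of_injective`). Hence the two mixtures differ only through the
tuples with repetitions, whose weights are at most `k ^ 2 / r` and `k ^ 2 / D ≤ k ^ 2 / r` by the
birthday bound (`card_not_injective_div_le`). The trace norm of a difference of two positive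
semidefinite matrices is at most the sum of their traces (`traceNorm_sub_le`), and this turns the
weights into the bound (`traceNorm_mixture_sub_le`).
-/

namespace SWSSB

open scoped ComplexOrder

attribute [local instance] completeSpace_of_finiteDimensional

/-! ### The trace norm of a difference of positive matrices -/

section traceNorm

variable {n : Type*} [Fintype n] [DecidableEq n]

theorem traceNorm_eq_sum_abs_eigenvalues {A : Matrix n n ℂ} (hA : A.IsHermitian) :
    traceNorm A = ∑ i, |hA.eigenvalues i| := by
  -- By the spectral theorem, `Aᴴ * A` is similar to the diagonal matrix of squared eigenvalues.
  have hsq : (A.conjTranspose * A).charpoly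
      = (Matrix.diagonal fun i => ((hA.eigenvalues i : ℂ) ^ 2)).charpoly := by
    set W := hA.eigenvectorUnitary
    set L : Matrix n n ℂ := Matrix.diagonal (RCLike.ofReal ∘ hA.eigenvalues) with hL
    have hs : A = (W : Matrix n n ℂ) * L * star (W : Matrix n n ℂ) := by
      have := hA.spectral_theorem
      rwa [Unitary.conjStarAlgAut_apply] at this
    have hW : star (W : Matrix n n ℂ) * (W : Matrix n n ℂ) = 1 := Unitary.coe_star_mul_self W
    have hAA : A.conjTranspose * A
        = (W : Matrix n n ℂ) * (L * L * star (W : Matrix n n ℂ)) := by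
      rw [hA.eq]
      nth_rewrite 1 [hs]
      nth_rewrite 1 [hs]
      calc _ = (W : Matrix n n ℂ) * (L * (star (W : Matrix n n ℂ) * (W : Matrix n n ℂ)) * L
            * star (W : Matrix n n ℂ)) := by simp only [mul_assoc]
        _ = _ := by rw [hW, mul_one]
    rw [hAA, Matrix.charpoly_mul_comm, mul_assoc, hW, mul_one, hL, Matrix.diagonal_mul_diagonal]
    simp [pow_two]
  have hroots := congrArg Polynomial.roots hsq
  rw [(Matrix.isHermitian_conjTranspose_mul_self A).roots_charpoly_eq_eigenvalues,
    Matrix.charpoly_diagonal, Polynomial.roots_prod _ _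
      (Finset.prod_ne_zero_iff.mpr fun i _ => Polynomial.X_sub_C_ne_zero _)] at hroots
  simp only [Polynomial.roots_X_sub_C, Multiset.bind_singleton] at hroots
  have hsum := congrArg (fun s : Multiset ℂ => (s.map fun z => Real.sqrt z.re).sum) hroots
  simp only [Multiset.map_map] at hsum
  calc traceNorm A = _ := hsum
    _ = ∑ i, |hA.eigenvalues i| := by
      refine Finset.sum_congr rfl fun i _ => ?_
      simp only [Function.comp_apply, ← Complex.ofReal_pow, Complex.ofReal_re, Real.sqrt_sq_eq_abs]

/-- The diagonal entries of a matrix in an orthonormal basis add up to its trace. -/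
theorem sum_star_dotProduct_mulVec_eq_trace (b : OrthonormalBasis n ℂ (EuclideanSpace ℂ n))
    (A : Matrix n n ℂ) : ∑ i, star (b i).ofLp ⬝ᵥ A.mulVec (b i).ofLp = A.trace := by
  have h := LinearMap.trace_eq_sum_inner (Matrix.toEuclideanLin A) b
  have htr : LinearMap.trace ℂ (EuclideanSpace ℂ n) (Matrix.toEuclideanLin A) = A.trace :=
    (congrArg (fun e => LinearMap.trace ℂ (EuclideanSpace ℂ n) (e A))
      (Matrix.toLpLin_eq_toLin 2 2)).trans (Matrix.trace_toLin_eq A _)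
  rw [← htr, h]
  refine Finset.sum_congr rfl fun i _ => ?_
  rw [EuclideanSpace.inner_eq_star_dotProduct, dotProduct_comm]
  rfl

/-- In an eigenbasis of `A - B` every eigenvalue is a difference of diagonal entries of `A` and `B`,
which are nonnegative and add up to the traces. -/
theorem traceNorm_sub_le {A B : Matrix n n ℂ} (hA : A.PosSemidef) (hB : B.PosSemidef) :
    traceNorm (A - B) ≤ A.trace.re + B.trace.re := by
  have hH : (A - B).IsHermitian := hA.isHermitian.sub hB.isHermitian
  rw [traceNorm_eq_sum_abs_eigenvalues hH,
    ← sum_star_dotProduct_mulVec_eq_trace hH.eigenvectorBasis A,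
    ← sum_star_dotProduct_mulVec_eq_trace hH.eigenvectorBasis B, Complex.re_sum, Complex.re_sum,
    ← Finset.sum_add_distrib]
  refine Finset.sum_le_sum fun i _ => ?_
  have h1 := hA.re_dotProduct_nonneg (hH.eigenvectorBasis i).ofLp
  have h2 := hB.re_dotProduct_nonneg (hH.eigenvectorBasis i).ofLp
  rw [hH.eigenvalues_eq, Matrix.sub_mulVec, dotProduct_sub, map_sub]
  simp only [RCLike.re_to_complex] at h1 h2 ⊢
  rw [abs_le]
  constructor <;> linarith

end traceNorm

/-! ### Tuples with repetitions -/

section collisions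

/-- The birthday bound `1 - r (r - 1) ⋯ (r - k + 1) / r ^ k ≤ k ^ 2 / r`, cleared of denominators. -/
theorem pow_succ_le_descFactorial_mul_add (r k : ℕ) :
    (r : ℝ) ^ k * r ≤ r.descFactorial k * r + (k : ℝ) ^ 2 * (r : ℝ) ^ k := by
  induction k with
  | zero => simp
  | succ k ih =>
    rcases le_total r k with h | h
    · have h' : (r : ℝ) ≤ ((k + 1 : ℕ) : ℝ) ^ 2 := by
        have : (r : ℝ) ≤ k := by exact_mod_cast h
        push_cast
        nlinarith [(Nat.cast_nonneg k : (0 : ℝ) ≤ k)]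
      have : (r : ℝ) ^ (k + 1) * r ≤ ((k + 1 : ℕ) : ℝ) ^ 2 * (r : ℝ) ^ (k + 1) := by
        rw [mul_comm]; gcongr
      have h0 : (0 : ℝ) ≤ (r.descFactorial (k + 1) : ℝ) * r := by positivity
      linarith
    · rw [Nat.descFactorial_succ]
      push_cast [Nat.cast_sub h]
      have hk : (k : ℝ) ≤ r := by exact_mod_cast h
      have h1 := mul_le_mul_of_nonneg_left ih (sub_nonneg.mpr hk)
      have h2 : (0 : ℝ) ≤ (k : ℝ) ^ 3 * (r : ℝ) ^ k := by positivity
      have h3 : (0 : ℝ) ≤ (k : ℝ) * (r : ℝ) ^ (k + 1) := by positivity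
      have h4 : (0 : ℝ) ≤ (r : ℝ) ^ (k + 1) := by positivity
      rw [pow_succ] at *
      nlinarith

variable {ι : Type*} [DecidableEq ι]

/-- Tuples in a set of size `r` that repeat an entry: at most a fraction `k ^ 2 / r` of all. -/
theorem card_not_injective_div_le (S : Finset ι) (hS : S.Nonempty) (k : ℕ) :
    (((Fintype.piFinset fun _ : Fin k => S).filter fun f => ¬ Function.Injective f).card : ℝ)
        / (S.card : ℝ) ^ k ≤ (k : ℝ) ^ 2 / S.card := by
  have hinj : ((Fintype.piFinset fun _ : Fin k => S).filter Function.Injective).card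
      = S.card.descFactorial k := by
    have := Fintype.card_embedding_eq (α := Fin k) (β := S)
    rw [Fintype.card_coe, Fintype.card_fin] at this
    rw [← this, ← Finset.card_univ]
    symm
    refine Finset.card_bij (fun g _ j => (g j : ι)) ?_ ?_ ?_
    · intro g _
      simp only [Finset.mem_filter, Fintype.mem_piFinset, Finset.coe_mem, implies_true, true_and]
      exact Subtype.val_injective.comp g.injective
    · intro g _ g' _ h
      ext j
      exact congrFun h j
    · intro f hf
      simp only [Finset.mem_filter, Fintype.mem_piFinset] at hf
      exact ⟨⟨fun j => ⟨f j, hf.1 j⟩, fun a b h => hf.2 (congrArg Subtype.val h)⟩, by simp, rfl⟩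
  have hcard := Finset.card_filter_add_card_filter_not
    (s := Fintype.piFinset fun _ : Fin k => S) (p := Function.Injective)
  rw [hinj, Fintype.card_piFinset_const] at hcard
  have hr : (0 : ℝ) < S.card := by exact_mod_cast hS.card_pos
  have hle := pow_succ_le_descFactorial_mul_add S.card k
  rw [div_le_div_iff₀ (by positivity) hr]
  have hcard' : (S.card.descFactorial k : ℝ)
      + ((Fintype.piFinset fun _ : Fin k => S).filter fun f => ¬ Function.Injective f).card
      = (S.card : ℝ) ^ k := by exact_mod_cast hcard
  rw [← hcard'] at hle ⊢
  linarith

variable [Fintype ι] {n : Type*} [Fintype n] [DecidableEq n]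

/-- If the states `M f` agree on all injective tuples `f`, then the uniform mixtures over the
tuples in `S` and over all tuples differ only through the weights of the tuples with repetitions. -/
theorem traceNorm_mixture_sub_le {k : ℕ} (S : Finset ι) (hS : S.Nonempty)
    (M : (Fin k → ι) → Matrix n n ℂ) (hpos : ∀ f, (M f).PosSemidef) (htr : ∀ f, (M f).trace = 1)
    (hM : ∀ f g, Function.Injective f → Function.Injective g → M f = M g) :
    traceNorm (((S.card : ℂ) ^ k)⁻¹ • ∑ f ∈ Fintype.piFinset fun _ => S, M f
        - ((Fintype.card ι : ℂ) ^ k)⁻¹ • ∑ f, M f) ≤ 4 * ((k : ℝ) ^ 2 / S.card) := by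
  -- If `k` exceeds `Fintype.card ι`, no tuple is injective and any state serves as `M₀`.
  obtain ⟨M₀, hM₀, hM₀pos, hM₀tr⟩ : ∃ M₀, (∀ f, Function.Injective f → M f = M₀) ∧
      M₀.PosSemidef ∧ M₀.trace = 1 := by
    by_cases h : ∃ f : Fin k → ι, Function.Injective f
    · obtain ⟨g, hg⟩ := h
      exact ⟨M g, fun f hf => hM f g hf hg, hpos g, htr g⟩
    · obtain ⟨s, -⟩ := hS
      exact ⟨M fun _ => s, fun f hf => (h ⟨f, hf⟩).elim, hpos _, htr _⟩
  -- `q T` is the weight of the tuples with repetitions, and `B T` their share of the mixture.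
  let bad : Finset ι → Finset (Fin k → ι) := fun T =>
    (Fintype.piFinset fun _ => T).filter fun f => ¬ Function.Injective f
  let q : Finset ι → ℝ := fun T => (bad T).card / (T.card : ℝ) ^ k
  let B : Finset ι → Matrix n n ℂ := fun T => (((T.card : ℝ) ^ k)⁻¹ : ℝ) • ∑ f ∈ bad T, M f
  have hq0 : ∀ T, 0 ≤ q T := fun T => by positivity
  have hBpos : ∀ T, (B T).PosSemidef := fun T =>
    (Matrix.posSemidef_sum _ fun f _ => hpos f).smul (by positivity)
  have hBtr : ∀ T, (B T).trace.re = q T := fun T => by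
    simp only [B, q, Matrix.trace_smul, Matrix.trace_sum, htr, Complex.smul_re]
    simp [div_eq_inv_mul]
  have hsplit : ∀ T : Finset ι, T.Nonempty →
      ((T.card : ℂ) ^ k)⁻¹ • ∑ f ∈ Fintype.piFinset fun _ => T, M f = (1 - q T) • M₀ + B T := by
    intro T hT
    have hT0 : (T.card : ℝ) ^ k ≠ 0 := by
      have : (0 : ℝ) < T.card := by exact_mod_cast hT.card_pos
      positivity
    rw [← Finset.sum_filter_add_sum_filter_not (Fintype.piFinset fun _ => T) Function.Injective M,
      Finset.sum_congr rfl fun f hf => hM₀ f (Finset.mem_filter.mp hf).2, Finset.sum_const]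
    have hcard := Finset.card_filter_add_card_filter_not
      (s := Fintype.piFinset fun _ : Fin k => T) (p := Function.Injective)
    rw [Fintype.card_piFinset_const] at hcard
    have hw : 1 - q T = ((T.card : ℝ) ^ k)⁻¹ *
        ((Fintype.piFinset fun _ : Fin k => T).filter Function.Injective).card := by
      have hcard' : (((Fintype.piFinset fun _ : Fin k => T).filter Function.Injective).card : ℝ)
          = (T.card : ℝ) ^ k - (bad T).card := by
        rw [eq_sub_iff_add_eq]; exact_mod_cast hcard
      rw [hcard']
      simp only [q]
      field_simp
    have hc : ((T.card : ℂ) ^ k)⁻¹ = ((((T.card : ℝ) ^ k)⁻¹ : ℝ) : ℂ) := by push_cast; rfl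
    rw [hw, hc, smul_add, Complex.coe_smul, Complex.coe_smul, mul_smul, Nat.cast_smul_eq_nsmul]
  have hu : (Finset.univ : Finset ι).Nonempty := ⟨_, Finset.mem_univ hS.choose⟩
  have h2 := hsplit Finset.univ hu
  rw [Fintype.piFinset_univ, Finset.card_univ] at h2
  rw [hsplit S hS, h2]
  -- The weights of `M₀` are `1 - q S` and `1 - q univ`; moving terms across makes both sides
  -- positive without comparing the two weights.
  have hrearr : (1 - q S) • M₀ + B S - ((1 - q Finset.univ) • M₀ + B Finset.univ)
      = (q Finset.univ • M₀ + B S) - (q S • M₀ + B Finset.univ) := by module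
  rw [hrearr]
  have hqS : q S ≤ (k : ℝ) ^ 2 / S.card := card_not_injective_div_le S hS k
  have hqU : q Finset.univ ≤ (k : ℝ) ^ 2 / S.card := by
    refine (card_not_injective_div_le Finset.univ hu k).trans ?_
    have : (0 : ℝ) < S.card := by exact_mod_cast hS.card_pos
    gcongr
    exact Finset.subset_univ S
  refine (traceNorm_sub_le ((hM₀pos.smul (hq0 _)).add (hBpos _))
    ((hM₀pos.smul (hq0 _)).add (hBpos _))).trans ?_
  simp only [Matrix.trace_add, Matrix.trace_smul, hM₀tr, Complex.add_re, hBtr, Complex.smul_re,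
    Complex.one_re, smul_eq_mul, mul_one]
  linarith

end collisions

/-! ### Haar measure on the unitary group -/

section haar

variable (F : Type*) [NormedAddCommGroup F] [InnerProductSpace ℂ F] [FiniteDimensional ℂ F]

instance isHaarMeasure_haarUnitary : (haarUnitary F).IsHaarMeasure := by
  unfold haarUnitary; infer_instance

instance isProbabilityMeasure_haarUnitary : IsProbabilityMeasure (haarUnitary F) :=
  ⟨Measure.haarMeasure_self (K₀ := (⊤ : TopologicalSpace.PositiveCompacts (UnitaryOn F)))⟩

/-- Compact groups are unimodular: a right translate of the Haar probability measure is again a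
Haar probability measure, hence the same one. -/
instance isMulRightInvariant_haarUnitary : (haarUnitary F).IsMulRightInvariant where
  map_mul_right_eq_self g := by
    have : IsProbabilityMeasure (Measure.map (· * g) (haarUnitary F)) :=
      Measure.isProbabilityMeasure_map (measurable_mul_const g).aemeasurable
    exact Measure.isHaarMeasure_eq_of_isProbabilityMeasure _ _

theorem integral_haarUnitary_mul_right (f : UnitaryOn F → ℂ) (g : UnitaryOn F) :
    ∫ U, f (U * g) ∂haarUnitary F = ∫ U, f U ∂haarUnitary F :=
  integral_mul_right_eq_self f g

theorem integrable_haarUnitary_of_continuous {f : UnitaryOn F → ℂ} (hf : Continuous f) :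
    Integrable f (haarUnitary F) :=
  hf.integrable_of_hasCompactSupport (HasCompactSupport.of_compactSpace f)

end haar

/-! ### Tensor powers -/

section tensorPower

variable {n : Type*} {k : ℕ}

/-- The product vector `v (f 0) ⊗ ⋯ ⊗ v (f (k - 1))`, in the product basis. -/
def productVec {ι : Type*} (v : ι → n → ℂ) (f : Fin k → ι) (x : Fin k → n) : ℂ :=
  ∏ j, v (f j) (x j)

theorem tensorPower_sum_vecMulVec {ι : Type*} [DecidableEq ι] (S : Finset ι) (v : ι → n → ℂ) :
    tensorPower k (∑ i ∈ S, Matrix.vecMulVec (v i) (star (v i)))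
      = ∑ f ∈ Fintype.piFinset fun _ => S,
          Matrix.vecMulVec (productVec v f) (star (productVec v f)) := by
  ext x y
  simp only [tensorPower, Matrix.of_apply, Matrix.sum_apply, Matrix.vecMulVec_apply,
    Finset.prod_univ_sum, Pi.star_apply, productVec, star_prod, Finset.prod_mul_distrib]

theorem tensorPower_smul (c : ℂ) (A : Matrix n n ℂ) :
    tensorPower k (c • A) = c ^ k • tensorPower k A := by
  ext x y
  simp [tensorPower, Finset.prod_mul_distrib]

theorem tensorPower_mul [Fintype n] (A B : Matrix n n ℂ) :
    tensorPower k (A * B) = tensorPower k A * tensorPower k B := by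
  ext x y
  simp only [tensorPower, Matrix.of_apply, Matrix.mul_apply, Finset.prod_univ_sum,
    Finset.prod_mul_distrib, Fintype.piFinset_univ]

theorem tensorPower_one [DecidableEq n] : tensorPower k (1 : Matrix n n ℂ) = 1 := by
  ext x y
  simp [tensorPower, Matrix.one_apply, Finset.prod_ite_zero, funext_iff]

theorem conjTranspose_tensorPower (A : Matrix n n ℂ) :
    (tensorPower k A).conjTranspose = tensorPower k A.conjTranspose := by
  ext x y
  simp [tensorPower]

theorem trace_tensorPower [Fintype n] [DecidableEq n] (A : Matrix n n ℂ) :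
    (tensorPower k A).trace = A.trace ^ k := by
  have h := Finset.prod_univ_sum (fun _ : Fin k => (Finset.univ : Finset n)) fun _ i => A i i
  simp only [Finset.prod_const, Finset.card_univ, Fintype.card_fin, Fintype.piFinset_univ] at h
  simp only [Matrix.trace, Matrix.diag_apply, tensorPower, Matrix.of_apply]
  exact h.symm

end tensorPower

/-! ### Projectors in an adapted orthonormal basis -/

section projector

variable {n : Type*} [Fintype n] {K : Submodule ℂ (EuclideanSpace ℂ n)}

/-- An orthonormal basis of `K` adapted to a subspace `R` of `K`. -/
theorem exists_orthonormalBasis_adapted {R : Submodule ℂ (EuclideanSpace ℂ n)} (hRK : R ≤ K) :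
    ∃ (u : Finset K) (b : OrthonormalBasis u ℂ K) (S : Finset u), S.card = Module.finrank ℂ R ∧
      (∀ i ∈ S, (b i : EuclideanSpace ℂ n) ∈ R) ∧
      (∀ i ∉ S, ∀ v ∈ R, inner ℂ (b i : EuclideanSpace ℂ n) v = 0) := by
  classical
  let o := stdOrthonormalBasis ℂ R
  let w : Fin (Module.finrank ℂ R) → K := fun i => ⟨o i, hRK (o i).2⟩
  have hw : Orthonormal ℂ w := ⟨fun i => o.orthonormal.1 i, fun i j h => o.orthonormal.2 h⟩
  obtain ⟨u, b, hwu, hb⟩ := hw.toSubtypeRange.exists_orthonormalBasis_extension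
  refine ⟨u, b, Finset.univ.image fun i => ⟨w i, hwu ⟨i, rfl⟩⟩, ?_, ?_, ?_⟩
  · rw [Finset.card_image_of_injective _ fun i j h =>
      hw.linearIndependent.injective (congrArg Subtype.val h), Finset.card_univ, Fintype.card_fin]
  · intro i hi
    obtain ⟨j, -, rfl⟩ := Finset.mem_image.mp hi
    simp only [hb, w]
    exact (o j).2
  · intro i hi v hv
    have hexp := congrArg Subtype.val (o.sum_repr' ⟨v, hv⟩)
    simp only [Submodule.coe_sum, Submodule.coe_smul] at hexp
    rw [← hexp, inner_sum]
    refine Finset.sum_eq_zero fun j _ => ?_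
    rw [inner_smul_right]
    have hne : i ≠ ⟨w j, hwu ⟨j, rfl⟩⟩ := fun h =>
      hi (Finset.mem_image.mpr ⟨j, Finset.mem_univ _, h.symm⟩)
    have horth := b.orthonormal.2 hne
    simp only [hb, Submodule.coe_inner, w] at horth ⊢
    rw [horth, mul_zero]

variable [DecidableEq n]

theorem inner_toEuclideanLin_of_isHermitian {P : Matrix n n ℂ} (hP : P.IsHermitian)
    (v w : EuclideanSpace ℂ n) :
    inner ℂ v (Matrix.toEuclideanLin P w) = inner ℂ (Matrix.toEuclideanLin P v) w :=
  ((Matrix.isSymmetric_toEuclideanLin_iff.mpr hP) v w).symm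

/-- The entry `P x y` is read off from the expansion in `b` of the image under `P` of the basis
vector at `y`. -/
theorem eq_sum_vecMulVec_of_basis {ι : Type*} [Fintype ι] {P : Matrix n n ℂ} (hP : P.IsHermitian)
    (hK : LinearMap.range (Matrix.toEuclideanLin P) ≤ K) (b : OrthonormalBasis ι ℂ K)
    (S : Finset ι) (h1 : ∀ i ∈ S, Matrix.toEuclideanLin P (b i) = b i)
    (h0 : ∀ i ∉ S, Matrix.toEuclideanLin P (b i) = 0) :
    P = ∑ i ∈ S, Matrix.vecMulVec (b i : EuclideanSpace ℂ n).ofLp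
      (star (b i : EuclideanSpace ℂ n).ofLp) := by
  ext x y
  let e : EuclideanSpace ℂ n := EuclideanSpace.single y 1
  have hmem : Matrix.toEuclideanLin P e ∈ K := hK ⟨e, rfl⟩
  have hexp := congrArg (Subtype.val) (b.sum_repr' ⟨_, hmem⟩)
  simp only [Submodule.coe_sum, Submodule.coe_smul, Submodule.coe_inner,
    inner_toEuclideanLin_of_isHermitian hP] at hexp
  rw [← Finset.sum_subset (Finset.subset_univ S) fun i _ hi => by rw [h0 i hi]; simp,
    Finset.sum_congr rfl fun i hi => by rw [h1 i hi]] at hexp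
  have hx := congrArg (fun v : EuclideanSpace ℂ n => v x) hexp
  have hP' : Matrix.toEuclideanLin P e x = P x y := by
    simp [e, Matrix.toLpLin_apply]
  rw [hP'] at hx
  rw [← hx]
  simp [e, Matrix.sum_apply, Matrix.vecMulVec_apply, EuclideanSpace.inner_single_right, mul_comm]

/-- A projector of rank `r` with range in `K` is the sum of the projectors onto `r` of the vectors
of an orthonormal basis of `K`. -/
theorem exists_orthonormalBasis_eq_sum_vecMulVec {P : Matrix n n ℂ} (hP : IsStarProjection P)
    (hK : LinearMap.range (Matrix.toEuclideanLin P) ≤ K) :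
    ∃ (u : Finset K) (b : OrthonormalBasis u ℂ K) (S : Finset u), S.card = P.rank ∧
      P = ∑ i ∈ S, Matrix.vecMulVec (b i : EuclideanSpace ℂ n).ofLp
        (star (b i : EuclideanSpace ℂ n).ofLp) := by
  have hH : P.IsHermitian := hP.isSelfAdjoint
  have hidem : ∀ v, Matrix.toEuclideanLin P (Matrix.toEuclideanLin P v)
      = Matrix.toEuclideanLin P v := fun v => by
    simp only [Matrix.toLpLin_apply, Matrix.mulVec_mulVec, hP.isIdempotentElem.eq]
  obtain ⟨u, b, S, hcard, hin, hout⟩ := exists_orthonormalBasis_adapted hK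
  have hrank : Module.finrank ℂ (LinearMap.range (Matrix.toEuclideanLin P)) = P.rank := by
    have he : Matrix.toEuclideanLin P
        = Matrix.toLin (PiLp.basisFun 2 ℂ n) (PiLp.basisFun 2 ℂ n) P :=
      LinearEquiv.congr_fun (Matrix.toLpLin_eq_toLin 2 2) P
    rw [he, ← Matrix.rank_eq_finrank_range_toLin]
  refine ⟨u, b, S, hcard.trans hrank, eq_sum_vecMulVec_of_basis hH hK b S (fun i hi => ?_)
    fun i hi => ?_⟩
  · obtain ⟨v, hv⟩ := hin i hi
    rw [← hv, hidem]
  · rw [← inner_self_eq_zero (𝕜 := ℂ), ← inner_toEuclideanLin_of_isHermitian hH, hidem]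
    exact hout i hi _ ⟨_, rfl⟩

end projector

/-! ### Haar averages of product states -/

section twirl

variable {n : Type*} [Fintype n] {K : Submodule ℂ (EuclideanSpace ℂ n)}
  {ι : Type*} [Fintype ι] {k : ℕ}

/-- The coordinates of the rotated basis vector `U (b i)`. -/
noncomputable def rotatedVec (b : OrthonormalBasis ι ℂ K) (U : UnitaryOn K) (i : ι) : n → ℂ :=
  ((U : K →L[ℂ] K) (b i) : EuclideanSpace ℂ n).ofLp

/-- The Haar average of the pure product states `U (b (f 0)) ⊗ ⋯ ⊗ U (b (f (k - 1)))`, as density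
matrices. -/
noncomputable def productTwirl (b : OrthonormalBasis ι ℂ K) (f : Fin k → ι) :
    Matrix (Fin k → n) (Fin k → n) ℂ :=
  Matrix.of fun x y => ∫ U, productVec (rotatedVec b U) f x *
    star (productVec (rotatedVec b U) f y) ∂haarUnitary K

theorem continuous_productVec_rotatedVec (b : OrthonormalBasis ι ℂ K) (f : Fin k → ι)
    (x : Fin k → n) : Continuous fun U => productVec (rotatedVec b U) f x := by
  unfold productVec rotatedVec
  refine continuous_finsetProd _ fun j _ => ?_
  have h : Continuous fun U : UnitaryOn K =>
      ((U : K →L[ℂ] K) (b (f j)) : EuclideanSpace ℂ n) :=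
    continuous_subtype_val.comp (continuous_subtype_val.clm_apply continuous_const)
  exact (EuclideanSpace.proj (𝕜 := ℂ) (x j)).continuous.comp h

theorem integrable_productVec_mul_star (b : OrthonormalBasis ι ℂ K) (f : Fin k → ι)
    (x y : Fin k → n) :
    Integrable (fun U => productVec (rotatedVec b U) f x *
      star (productVec (rotatedVec b U) f y)) (haarUnitary K) :=
  integrable_haarUnitary_of_continuous K ((continuous_productVec_rotatedVec b f x).mul
    (continuous_productVec_rotatedVec b f y).star)

theorem productTwirl_posSemidef (b : OrthonormalBasis ι ℂ K) (f : Fin k → ι) :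
    (productTwirl b f).PosSemidef := by
  refine Matrix.PosSemidef.of_dotProduct_mulVec_nonneg ?_ fun v => ?_
  · ext x y
    simp only [productTwirl, Matrix.conjTranspose_apply, Matrix.of_apply, ← starRingEnd_apply,
      ← integral_conj]
    simp [mul_comm]
  · have hint : star v ⬝ᵥ (productTwirl b f).mulVec v = ∫ U,
        ((Complex.normSq (∑ x, star (v x) * productVec (rotatedVec b U) f x) : ℝ) : ℂ)
          ∂haarUnitary K := by
      have hexp : ∀ U : UnitaryOn K,
          ((Complex.normSq (∑ x, star (v x) * productVec (rotatedVec b U) f x) : ℝ) : ℂ)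
            = ∑ x, ∑ y, star (v x) * (productVec (rotatedVec b U) f x *
              star (productVec (rotatedVec b U) f y) * v y) := fun U => by
        rw [← Complex.mul_conj, starRingEnd_apply, star_sum, Finset.sum_mul_sum]
        refine Finset.sum_congr rfl fun x _ => Finset.sum_congr rfl fun y _ => ?_
        rw [star_mul', star_star]
        ring
      have hterm : ∀ x y, Integrable (fun U => star (v x) * (productVec (rotatedVec b U) f x *
          star (productVec (rotatedVec b U) f y) * v y)) (haarUnitary K) := fun x y =>
        ((integrable_productVec_mul_star b f x y).mul_const _).const_mul _
      simp only [hexp]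
      rw [integral_finsetSum _ fun x _ => integrable_finsetSum _ fun y _ => hterm x y]
      simp only [integral_finsetSum _ fun y _ => hterm _ y, integral_const_mul,
        integral_mul_const, dotProduct, Matrix.mulVec, productTwirl, Matrix.of_apply,
        Pi.star_apply, Finset.mul_sum]
    rw [hint, integral_complex_ofReal]
    exact_mod_cast integral_nonneg fun U => Complex.normSq_nonneg _

theorem sum_rotatedVec_mul_star (b : OrthonormalBasis ι ℂ K) (U : UnitaryOn K) (i : ι) :
    ∑ x, rotatedVec b U i x * star (rotatedVec b U i x) = 1 := by
  have h : ‖((U : K →L[ℂ] K) (b i) : EuclideanSpace ℂ n)‖ = 1 :=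
    (Unitary.norm_map U (b i)).trans (b.norm_eq_one i)
  have h2 := inner_self_eq_norm_sq_to_K (𝕜 := ℂ) ((U : K →L[ℂ] K) (b i) : EuclideanSpace ℂ n)
  rw [h, EuclideanSpace.inner_eq_star_dotProduct] at h2
  simpa [dotProduct, rotatedVec] using h2

theorem trace_productTwirl (b : OrthonormalBasis ι ℂ K) (f : Fin k → ι) :
    (productTwirl b f).trace = 1 := by
  simp only [Matrix.trace, Matrix.diag_apply, productTwirl, Matrix.of_apply]
  rw [← integral_finsetSum _ fun x _ => integrable_productVec_mul_star b f x x]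
  have h : ∀ U : UnitaryOn K, ∑ x, productVec (rotatedVec b U) f x *
      star (productVec (rotatedVec b U) f x) = 1 := fun U => by
    have h := Finset.prod_univ_sum (fun _ : Fin k => (Finset.univ : Finset n))
      fun j x => rotatedVec b U (f j) x * star (rotatedVec b U (f j) x)
    simp only [sum_rotatedVec_mul_star, Finset.prod_const_one, Fintype.piFinset_univ] at h
    rw [h]
    simp only [productVec, star_prod, Finset.prod_mul_distrib]
  simp only [h, integral_const, probReal_univ, one_smul]

/-- Two injective tuples of basis vectors are related by a permutation of the basis, that is, by a
unitary, which the Haar average absorbs. -/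
theorem productTwirl_eq_of_injective (b : OrthonormalBasis ι ℂ K) {f g : Fin k → ι}
    (hf : Function.Injective f) (hg : Function.Injective g) :
    productTwirl b f = productTwirl b g := by
  classical
  let σ : Equiv.Perm ι := ((Equiv.ofInjective f hf).symm.trans
    (Equiv.ofInjective g hg)).extendSubtype
  have hσ : ∀ j, σ (f j) = g j := fun j => by
    have := Equiv.extendSubtype_apply_of_mem ((Equiv.ofInjective f hf).symm.trans
      (Equiv.ofInjective g hg)) (f j) ⟨j, rfl⟩
    refine this.trans ?_
    have h2 : (Equiv.ofInjective f hf).symm ⟨f j, ⟨j, rfl⟩⟩ = j :=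
      (Equiv.ofInjective f hf).symm_apply_eq.mpr rfl
    simp [h2]
  let W : UnitaryOn K := Unitary.linearIsometryEquiv.symm (b.equiv b σ)
  have hW : ∀ U i, rotatedVec b (U * W) i = rotatedVec b U (σ i) := fun U i => by
    have : (W : K →L[ℂ] K) (b i) = b (σ i) := b.equiv_apply_basis b σ i
    simp only [rotatedVec, Submonoid.coe_mul, mul_apply_eq_comp, this]
  ext x y
  simp only [productTwirl, Matrix.of_apply]
  rw [← integral_haarUnitary_mul_right K
    (fun U => productVec (rotatedVec b U) f x * star (productVec (rotatedVec b U) f y)) W]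
  simp only [productVec, hW, hσ]

/-- A Haar average of tensor powers, expanded over tuples of basis vectors. -/
theorem integral_tensorPower_eq_sum_productTwirl [DecidableEq ι] (b : OrthonormalBasis ι ℂ K)
    (S : Finset ι) (A : UnitaryOn K → Matrix n n ℂ) (c : ℂ)
    (hA : ∀ U, A U = c • ∑ i ∈ S, Matrix.vecMulVec (rotatedVec b U i) (star (rotatedVec b U i))) :
    (Matrix.of fun x y => ∫ U, tensorPower k (A U) x y ∂haarUnitary K)
      = c ^ k • ∑ f ∈ Fintype.piFinset fun _ => S, productTwirl b f := by
  ext x y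
  simp only [hA, tensorPower_smul, tensorPower_sum_vecMulVec, Matrix.of_apply, Matrix.smul_apply,
    Matrix.sum_apply, Matrix.vecMulVec_apply, Pi.star_apply, smul_eq_mul, integral_const_mul,
    productTwirl]
  rw [integral_finsetSum _ fun f _ => integrable_productVec_mul_star b f x y]

end twirl

/-! ### The symmetry sector -/

section sector

variable {N : ℕ}

theorem xBar_mul_self : xBar N * xBar N = 1 := by
  rw [xBar, ← tensorPower_mul, ← tensorPower_one]
  congr 1
  ext i j; fin_cases i <;> fin_cases j <;> simp

theorem xBar_isHermitian : (xBar N).IsHermitian := by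
  rw [Matrix.IsHermitian, xBar, conjTranspose_tensorPower]
  congr 1
  ext i j; fin_cases i <;> fin_cases j <;> simp

theorem trace_xBar (hN : N ≠ 0) : (xBar N).trace = 0 := by
  simp [xBar, trace_tensorPower, Matrix.trace_fin_two, hN]

theorem mem_plusSector {v : Qubits N} :
    v ∈ plusSector N ↔ Matrix.toEuclideanLin (xBar N) v = v := by
  simp [plusSector]

/-- The projector onto `H₊` is the sum of the projectors onto the vectors of any orthonormal
basis of `H₊`. -/
theorem one_add_xBar_eq_sum {ι : Type*} [Fintype ι] (b : OrthonormalBasis ι ℂ (plusSector N)) :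
    (2 : ℂ)⁻¹ • (1 + xBar N) = ∑ i, Matrix.vecMulVec (b i : Qubits N).ofLp
      (star (b i : Qubits N).ofLp) := by
  have happ : ∀ v : Qubits N, Matrix.toEuclideanLin ((2 : ℂ)⁻¹ • (1 + xBar N)) v
      = (2 : ℂ)⁻¹ • (v + Matrix.toEuclideanLin (xBar N) v) := fun v => by
    simp [Matrix.toLpLin_apply]
  refine eq_sum_vecMulVec_of_basis ?_ ?_ b Finset.univ (fun i _ => ?_) fun i hi =>
    (hi (Finset.mem_univ i)).elim
  · rw [Matrix.IsHermitian, Matrix.conjTranspose_smul, Matrix.conjTranspose_add,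
      xBar_isHermitian.eq]
    simp
  · rintro _ ⟨v, rfl⟩
    have hXX : Matrix.toEuclideanLin (xBar N) (Matrix.toEuclideanLin (xBar N) v) = v := by
      simp [Matrix.toLpLin_apply, Matrix.mulVec_mulVec, xBar_mul_self]
    rw [mem_plusSector, happ, map_smul, map_add, hXX, add_comm]
  · rw [happ, mem_plusSector.mp (b i).2, ← two_smul ℂ, smul_smul]
    norm_num

theorem rhoZero_eq_sum (hN : N ≠ 0) {ι : Type*} [Fintype ι]
    (b : OrthonormalBasis ι ℂ (plusSector N)) (U : UnitaryOn (plusSector N)) :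
    rhoZero N = (Fintype.card ι : ℂ)⁻¹ •
      ∑ i, Matrix.vecMulVec (rotatedVec b U i) (star (rotatedVec b U i)) := by
  have hsum : (2 : ℂ)⁻¹ • (1 + xBar N)
      = ∑ i, Matrix.vecMulVec (rotatedVec b U i) (star (rotatedVec b U i)) :=
    one_add_xBar_eq_sum (b.map (Unitary.linearIsometryEquiv U))
  -- Taking traces: the sector has half of the dimension, as `xBar N` is traceless.
  have htr := congrArg Matrix.trace hsum
  simp only [Matrix.trace_smul, Matrix.trace_add, Matrix.trace_one, trace_xBar hN,
    Matrix.trace_sum, Matrix.trace_vecMulVec, dotProduct, Pi.star_apply,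
    sum_rotatedVec_mul_star] at htr
  simp at htr
  rw [← hsum, rhoZero, ← htr, smul_smul]
  congr 1
  field_simp

theorem sectorState_eq_sum {ι : Type*} [Fintype ι] (b : OrthonormalBasis ι ℂ (plusSector N))
    (S : Finset ι) (r : ℕ) {P : Matrix (Bits N) (Bits N) ℂ}
    (hP : P = ∑ i ∈ S, Matrix.vecMulVec (b i : Qubits N).ofLp (star (b i : Qubits N).ofLp))
    (U : UnitaryOn (plusSector N)) :
    sectorState r P U = (r : ℂ)⁻¹ •
      ∑ i ∈ S, Matrix.vecMulVec (rotatedVec b U i) (star (rotatedVec b U i)) := by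
  unfold sectorState
  set V : Matrix (Bits N) (Bits N) ℂ := (Matrix.toEuclideanCLM (n := Bits N) (𝕜 := ℂ)).symm
    (extendUnitary (plusSector N) U) with hV
  have hVb : ∀ i, V.mulVec (b i : Qubits N).ofLp = rotatedVec b U i := fun i => by
    rw [← Matrix.ofLp_toEuclideanCLM, hV, StarAlgEquiv.apply_symm_apply]
    simp [extendUnitary, rotatedVec]
  simp only [hP, Matrix.mul_sum, Matrix.sum_mul, Matrix.mul_vecMulVec, Matrix.vecMulVec_mul,
    ← Matrix.star_mulVec, hVb]

/-- The bound in its non-asymptotic form. -/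
theorem traceNorm_haarMoment_sub_le (hN : N ≠ 0) {r : ℕ} (hr : r ≠ 0) (k : ℕ)
    {P : Matrix (Bits N) (Bits N) ℂ} (hP : IsSectorProjector N r P) :
    traceNorm (haarMoment r k P - tensorPower k (rhoZero N)) ≤ 4 * ((k : ℝ) ^ 2 / r) := by
  classical
  obtain ⟨u, b, S, hcard, hsum⟩ :=
    exists_orthonormalBasis_eq_sum_vecMulVec hP.isStarProjection hP.range_le
  rw [hP.rank_eq] at hcard
  have hmoment := integral_tensorPower_eq_sum_productTwirl (k := k) b S (sectorState r P) _
    (sectorState_eq_sum b S r hsum)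
  have hrho := integral_tensorPower_eq_sum_productTwirl (k := k) b Finset.univ
    (fun _ => rhoZero N) _ (rhoZero_eq_sum hN b)
  have hrho' : (Matrix.of fun x y => ∫ _U : UnitaryOn (plusSector N),
      tensorPower k (rhoZero N) x y ∂haarUnitary (plusSector N)) = tensorPower k (rhoZero N) := by
    ext x y
    simp
  rw [hrho', Fintype.piFinset_univ] at hrho
  rw [haarMoment, hmoment, hrho, ← hcard, inv_pow, inv_pow]
  exact traceNorm_mixture_sub_le S (Finset.card_ne_zero.mp (hcard ▸ hr)) _
    (productTwirl_posSemidef b) (trace_productTwirl b)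
    fun f g hf hg => productTwirl_eq_of_injective b hf hg

end sector

end SWSSB

theorem lemma3 :
    ∃ C : ℝ, 0 < C ∧ ∀ r k : ℕ → ℕ,
      ((fun N : ℕ => Real.log (N : ℝ)) =o[atTop] fun N : ℕ => Real.log (r N : ℝ)) →
      ((fun N : ℕ => Real.log (r N : ℝ)) =o[atTop] fun N : ℕ => (N : ℝ)) →
      (∃ c : ℕ, (fun N : ℕ => (k N : ℝ)) =O[atTop] fun N : ℕ => (N : ℝ) ^ c) →
      ∀ᶠ N : ℕ in atTop, ∀ P : Matrix (SWSSB.Bits N) (SWSSB.Bits N) ℂ,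
        SWSSB.IsSectorProjector N (r N) P →
          SWSSB.traceNorm
              (SWSSB.haarMoment (r N) (k N) P - SWSSB.tensorPower (k N) (SWSSB.rhoZero N)) ≤
            C * ((k N : ℝ) ^ 2 / (r N : ℝ)) := by
  refine ⟨4, by norm_num, fun r k hr _ _ => ?_⟩
  filter_upwards [hr.bound one_pos, eventually_ge_atTop 2] with N hN hN2 P hP
  -- If `r N = 0`, the little-o bound would give `|log N| ≤ |log 0| = 0`.
  have hr0 : r N ≠ 0 := by
    intro h
    have hlog : 0 < Real.log N := Real.log_pos (by exact_mod_cast hN2)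
    rw [h] at hN
    simp at hN
    rcases hN with h | h | h
    · omega
    · omega
    · norm_cast at h
  exact SWSSB.traceNorm_haarMoment_sub_le (by omega) hr0 (k N) hP
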